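/- Let $n>1$, let $\phi:\mathbb{R}^n\to\mathbb{R}$ be continuously differentiable with $L$-Lipschitz gradient ($L>0$, Euclidean norms), and let $f:\mathbb{R}^n\to\mathbb{R}$ be a measurable function with $|f(y)-\phi(y)|\le\epsilon_f$ for all $y\in\mathbb{R}^n$, where $\epsilon_f\ge 0$ is a constant. Let $x\in\mathbb{R}^n$, $\theta\in(0,1)$, $\delta\in(0,1)$, $\sigma>0$, and let $u_1,\dots,u_N$ be independent random vectors with the standard normal distribution $\mathcal{N}(0,I)$ on $\mathbb{R}^n$. Let $$g(x)=\frac1N\sum_{i=1}^N\frac{f(x+\sigma u_i)-f(x)}{\sigma}\,u_i$$ be the Gaussian smoothed gradient (GSG) estimate. Suppose that $$N\ \ge\ \frac{3n}{\delta\theta^2}\,\frac{n}{(\sqrt n-1)^2}+\frac{n+4}{16\delta}+\frac1\delta,$$ $$\sqrt{\frac{\epsilon_f}{L}}\ \le\ \sigma\ \le\ \frac{\theta\|\nabla\phi(x)\|}{6nL},\qquad \|\nabla\phi(x)\|\ \ge\ \frac{6n\sqrt{L\epsilon_f}}{\theta}.$$ Then, with probability at least $1-\delta$, the norm condition $$\|g(x)-\nabla\phi(x)\|\le\theta\,\|\nabla\phi(x)\|$$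 holds. -/

import Mathlib

open scoped NNReal

/-- The Gaussian smoothed gradient (GSG) of `f` at `x` with sampling radius `σ` and sampling
directions `u 0, …, u (N - 1)`:
`g(x) = (1 / N) ∑ i, ((f (x + σ u i) - f x) / σ) u i`. -/
noncomputable def gaussianSmoothedGradient {n N : ℕ} (f : EuclideanSpace ℝ (Fin n) → ℝ)
    (σ : ℝ) (u : Fin N → EuclideanSpace ℝ (Fin n)) (x : EuclideanSpace ℝ (Fin n)) :
    EuclideanSpace ℝ (Fin n) :=
  (1 / (N : ℝ)) • ∑ i, ((f (x + σ • u i) - f x) / σ) • u i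

/-- The norm condition `‖g - ∇φ(x)‖ ≤ θ ‖∇φ(x)‖` for a gradient estimate `g` at `x`. -/
def NormCondition {n : ℕ} (φ : EuclideanSpace ℝ (Fin n) → ℝ) (θ : ℝ)
    (g x : EuclideanSpace ℝ (Fin n)) : Prop :=
  ‖g - gradient φ x‖ ≤ θ * ‖gradient φ x‖

/-! The estimate is the mean of `N` independent copies of `Y = q(u) u`, with `q` the forward
difference. The error `θ‖∇φ(x)‖` is split as 5/24 for the bias of `E Y` and 19/24 for sampling.

The bounds on `σ` give `εf ≤ Lσ²` and `6nLσ ≤ θ‖∇φ(x)‖`, so noise and Taylor remainder are both of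
order `Lσ`. If `q` were `⟪∇φ(x), u⟫`, then `E Y` would be exactly `∇φ(x)`. The noise at the base
point multiplies `u`, which has mean zero, and drops out; the rest costs at most `Lσ(n+3)/2`
(`norm_integral_forwardDifference_smul_sub_gradient_le`).

For sampling, Gaussian moments up to order six bound `E‖Y‖²` by `(29n/16 + 7/2)‖∇φ(x)‖²`. Chebyshev
(`sq_mul_measureReal_le_norm_mean_sub_le`) then applies, as `δθ²N ≥ 3n + 6` by
`linear_le_mul_of_sample_size`. -/

namespace GaussianSmoothing

open MeasureTheory ProbabilityTheory Real
open scoped RealInnerProductSpace ENNReal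

/-! ### Moments of the standard Gaussian up to order six -/

section GaussianMoments

/-- Differentiate the moment generating function `exp (v t² / 2)`. This starts the moment recursion.
-/
lemma integral_mul_exp_gaussianReal_eq (v : ℝ≥0) (t : ℝ) :
    ∫ x, x * exp (t * x) ∂(gaussianReal 0 v) = v * t * ∫ x, exp (t * x) ∂(gaussianReal 0 v) := by
  have hmem (s : ℝ) : s ∈ interior (integrableExpSet (fun x : ℝ ↦ x) (gaussianReal 0 v)) := by
    simp
  have h := hasDerivAt_mgf (hmem t)
  have hm (s : ℝ) : ∫ x, exp (s * x) ∂(gaussianReal 0 v) = exp (v * s ^ 2 / 2) := by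
    have := congrFun (mgf_fun_id_gaussianReal (μ := 0) (v := v)) s
    simpa [mgf] using this
  have hm' : mgf (fun x : ℝ ↦ x) (gaussianReal 0 v) = fun s ↦ exp (v * s ^ 2 / 2) :=
    funext hm
  rw [hm'] at h
  have h2 : HasDerivAt (fun s : ℝ ↦ exp (v * s ^ 2 / 2)) (v * t * exp (v * t ^ 2 / 2)) t := by
    have := ((((hasDerivAt_id t).pow 2).const_mul (v : ℝ)).div_const 2).exp
    convert! this using 1
    simp
    ring
  rw [hm, ← h.unique h2]

/-- Recursion for the exponentially tilted moments of a centred Gaussian. -/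
lemma integral_pow_mul_exp_gaussianReal_succ_succ (v : ℝ≥0) (k : ℕ) (t : ℝ) :
    ∫ x, x ^ (k + 2) * exp (t * x) ∂(gaussianReal 0 v)
      = v * t * ∫ x, x ^ (k + 1) * exp (t * x) ∂(gaussianReal 0 v)
        + v * (k + 1) * ∫ x, x ^ k * exp (t * x) ∂(gaussianReal 0 v) := by
  have hmem (s : ℝ) : s ∈ interior (integrableExpSet (fun x : ℝ ↦ x) (gaussianReal 0 v)) := by
    simp
  have hd (j : ℕ) (s : ℝ) := hasDerivAt_integral_pow_mul_exp_real (hmem s) j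
  induction k generalizing t with
  | zero =>
    -- Each identity is the `t`-derivative of the previous one; the product rule on `v * t` supplies
    -- the extra lower moment.
    have h1 := hd 1 t
    have h0 := ((hasDerivAt_id t).const_mul (v : ℝ)).mul (hd 0 t)
    have heq : (fun s : ℝ ↦ ∫ x, x ^ 1 * exp (s * x) ∂(gaussianReal 0 v))
        = (fun s : ℝ ↦ (v : ℝ) * id s) * fun s ↦ ∫ x, x ^ 0 * exp (s * x) ∂(gaussianReal 0 v) := by
      funext s
      simpa using integral_mul_exp_gaussianReal_eq v s
    rw [heq] at h1
    rw [h1.unique h0]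
    simp
    ring
  | succ k ih =>
    have h1 := hd (k + 2) t
    have h0 := (((hasDerivAt_id t).const_mul (v : ℝ)).mul (hd (k + 1) t)).add
      ((hd k t).const_mul ((v : ℝ) * (k + 1)))
    have heq : (fun s : ℝ ↦ ∫ x, x ^ (k + 2) * exp (s * x) ∂(gaussianReal 0 v))
        = ((fun s : ℝ ↦ (v : ℝ) * id s) *
            fun s ↦ ∫ x, x ^ (k + 1) * exp (s * x) ∂(gaussianReal 0 v))
          + fun s ↦ v * (k + 1) * ∫ x, x ^ k * exp (s * x) ∂(gaussianReal 0 v) := by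
      funext s
      simpa using ih s
    rw [heq] at h1
    rw [h1.unique h0]
    simp
    ring

lemma integral_pow_gaussianReal_succ_succ (v : ℝ≥0) (k : ℕ) :
    ∫ x, x ^ (k + 2) ∂(gaussianReal 0 v) = v * (k + 1) * ∫ x, x ^ k ∂(gaussianReal 0 v) := by
  simpa using integral_pow_mul_exp_gaussianReal_succ_succ v k 0

lemma integral_sq_gaussianReal (v : ℝ≥0) : ∫ x, x ^ 2 ∂(gaussianReal 0 v) = v := by
  simpa using integral_pow_gaussianReal_succ_succ v 0

lemma integral_pow_four_gaussianReal (v : ℝ≥0) :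
    ∫ x, x ^ 4 ∂(gaussianReal 0 v) = 3 * (v : ℝ) ^ 2 := by
  rw [integral_pow_gaussianReal_succ_succ v 2, integral_sq_gaussianReal]
  push_cast
  ring

lemma integral_pow_six_gaussianReal (v : ℝ≥0) :
    ∫ x, x ^ 6 ∂(gaussianReal 0 v) = 15 * (v : ℝ) ^ 3 := by
  rw [integral_pow_gaussianReal_succ_succ v 4, integral_pow_four_gaussianReal]
  push_cast
  ring

variable {E : Type*} [NormedAddCommGroup E] [InnerProductSpace ℝ E] [FiniteDimensional ℝ E]
  [MeasurableSpace E] [BorelSpace E]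

lemma map_inner_stdGaussian (v : E) :
    (stdGaussian E).map (fun u ↦ ⟪v, u⟫) = gaussianReal 0 (‖v‖₊ ^ 2) := by
  have h := IsGaussian.map_eq_gaussianReal (μ := stdGaussian E) (innerSL ℝ v)
  rw [integral_strongDual_stdGaussian, variance_dual_stdGaussian] at h
  have h2 : (‖innerSL ℝ v‖ ^ 2).toNNReal = ‖v‖₊ ^ 2 := by
    rw [innerSL_apply_norm]
    ext
    simp
  rw [h2] at h
  exact h

lemma integral_inner_pow_stdGaussian (v : E) (k : ℕ) :
    ∫ u, ⟪v, u⟫ ^ k ∂(stdGaussian E) = ∫ x, x ^ k ∂(gaussianReal 0 (‖v‖₊ ^ 2)) := by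
  rw [← map_inner_stdGaussian, integral_map (by fun_prop) (by fun_prop)]

lemma integrable_norm_pow_stdGaussian (k : ℕ) :
    Integrable (fun u : E ↦ ‖u‖ ^ k) (stdGaussian E) :=
  (IsGaussian.memLp_id (stdGaussian E) k (by simp)).integrable_norm_pow'

lemma integrable_of_le_norm_pow_stdGaussian {F : Type*} [NormedAddCommGroup F] {h : E → F} {C : ℝ}
    {k : ℕ} (hm : AEStronglyMeasurable h (stdGaussian E)) (hb : ∀ u, ‖h u‖ ≤ C * (1 + ‖u‖) ^ k) :
    Integrable h (stdGaussian E) := by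
  have hi : Integrable (fun u : E ↦ C * (1 + ‖u‖) ^ k) (stdGaussian E) := by
    refine Integrable.const_mul ?_ C
    simp_rw [add_comm (1 : ℝ), add_pow, one_pow, mul_one]
    exact integrable_finsetSum _ fun i _ ↦ (integrable_norm_pow_stdGaussian i).mul_const _
  exact hi.mono' hm (ae_of_all _ hb)

lemma integrable_inner_mul_stdGaussian (v w : E) :
    Integrable (fun u : E ↦ ⟪v, u⟫ * ⟪w, u⟫) (stdGaussian E) := by
  refine integrable_of_le_norm_pow_stdGaussian (C := ‖v‖ * ‖w‖) (k := 2) (by fun_prop) fun u ↦ ?_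
  rw [norm_mul]
  calc ‖⟪v, u⟫‖ * ‖⟪w, u⟫‖ ≤ (‖v‖ * ‖u‖) * (‖w‖ * ‖u‖) := by
        gcongr <;> exact norm_inner_le_norm _ _
    _ = ‖v‖ * ‖w‖ * ‖u‖ ^ 2 := by ring
    _ ≤ _ := by gcongr; linarith

lemma integrable_inner_sq_mul_inner_sq_stdGaussian (v w : E) :
    Integrable (fun u : E ↦ ⟪v, u⟫ ^ 2 * ⟪w, u⟫ ^ 2) (stdGaussian E) := by
  refine integrable_of_le_norm_pow_stdGaussian (C := ‖v‖ ^ 2 * ‖w‖ ^ 2) (k := 4) (by fun_prop)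
    fun u ↦ ?_
  rw [norm_mul, norm_pow, norm_pow]
  calc ‖⟪v, u⟫‖ ^ 2 * ‖⟪w, u⟫‖ ^ 2 ≤ (‖v‖ * ‖u‖) ^ 2 * (‖w‖ * ‖u‖) ^ 2 := by
        gcongr <;> exact norm_inner_le_norm _ _
    _ = ‖v‖ ^ 2 * ‖w‖ ^ 2 * ‖u‖ ^ 4 := by ring
    _ ≤ _ := by gcongr; linarith

lemma integrable_inner_pow_stdGaussian (v : E) (k : ℕ) :
    Integrable (fun u : E ↦ ⟪v, u⟫ ^ k) (stdGaussian E) := by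
  refine integrable_of_le_norm_pow_stdGaussian (C := ‖v‖ ^ k) (k := k) (by fun_prop) fun u ↦ ?_
  rw [norm_pow, ← mul_pow]
  gcongr
  refine (norm_inner_le_norm _ _).trans ?_
  gcongr
  linarith

lemma integral_inner_sq_stdGaussian (v : E) :
    ∫ u, ⟪v, u⟫ ^ 2 ∂(stdGaussian E) = ‖v‖ ^ 2 := by
  simp [integral_inner_pow_stdGaussian, integral_sq_gaussianReal]

lemma integral_inner_pow_four_stdGaussian (v : E) :
    ∫ u, ⟪v, u⟫ ^ 4 ∂(stdGaussian E) = 3 * ‖v‖ ^ 4 := by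
  rw [integral_inner_pow_stdGaussian, integral_pow_four_gaussianReal]
  push_cast
  ring

lemma integral_inner_pow_six_stdGaussian (v : E) :
    ∫ u, ⟪v, u⟫ ^ 6 ∂(stdGaussian E) = 15 * ‖v‖ ^ 6 := by
  rw [integral_inner_pow_stdGaussian, integral_pow_six_gaussianReal]
  push_cast
  ring

lemma integral_inner_mul_inner_stdGaussian (v w : E) :
    ∫ u, ⟪v, u⟫ * ⟪w, u⟫ ∂(stdGaussian E) = ⟪v, w⟫ := by
  have h (u : E) : ⟪v, u⟫ * ⟪w, u⟫ = (⟪v + w, u⟫ ^ 2 - ⟪v - w, u⟫ ^ 2) / 4 := by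
    rw [inner_add_left, inner_sub_left]
    ring
  simp_rw [h]
  rw [integral_div, integral_sub (integrable_inner_pow_stdGaussian _ 2)
    (integrable_inner_pow_stdGaussian _ 2), integral_inner_sq_stdGaussian,
    integral_inner_sq_stdGaussian, norm_add_sq_real, norm_sub_sq_real]
  ring

/-- Isserlis' formula for two squared marginals, by polarization of the fourth moment. -/
lemma integral_inner_sq_mul_inner_sq_stdGaussian (v w : E) :
    ∫ u, ⟪v, u⟫ ^ 2 * ⟪w, u⟫ ^ 2 ∂(stdGaussian E) = ‖v‖ ^ 2 * ‖w‖ ^ 2 + 2 * ⟪v, w⟫ ^ 2 := by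
  have h (u : E) : ⟪v, u⟫ ^ 2 * ⟪w, u⟫ ^ 2 =
      ((⟪v + w, u⟫ ^ 4 + ⟪v - w, u⟫ ^ 4) - (2 * ⟪v, u⟫ ^ 4 + 2 * ⟪w, u⟫ ^ 4)) / 12 := by
    rw [inner_add_left, inner_sub_left]
    ring
  have hi (z : E) := integrable_inner_pow_stdGaussian z 4
  simp_rw [h]
  rw [integral_div, integral_sub (by exact (hi _).add (hi _))
      (by exact ((hi _).const_mul 2).add ((hi _).const_mul 2)),
    integral_add (hi _) (hi _), integral_add ((hi _).const_mul 2) ((hi _).const_mul 2),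
    integral_const_mul, integral_const_mul]
  simp_rw [integral_inner_pow_four_stdGaussian]
  have h1 : ‖v + w‖ ^ 4 = (‖v‖ ^ 2 + 2 * ⟪v, w⟫ + ‖w‖ ^ 2) ^ 2 := by
    rw [← norm_add_sq_real]; ring
  have h2 : ‖v - w‖ ^ 4 = (‖v‖ ^ 2 - 2 * ⟪v, w⟫ + ‖w‖ ^ 2) ^ 2 := by
    rw [← norm_sub_sq_real]; ring
  rw [h1, h2]
  ring

variable {ι : Type*} [Fintype ι]

/-- Expand `‖u‖²` in the basis and sum Isserlis' formula; Parseval turns the cross terms into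
`2‖v‖²`. -/
lemma integral_inner_sq_mul_norm_sq_stdGaussian (b : OrthonormalBasis ι ℝ E) (v : E) :
    ∫ u, ⟪v, u⟫ ^ 2 * ‖u‖ ^ 2 ∂(stdGaussian E) = (Fintype.card ι + 2) * ‖v‖ ^ 2 := by
  have h (u : E) : ⟪v, u⟫ ^ 2 * ‖u‖ ^ 2 = ∑ i, ⟪v, u⟫ ^ 2 * ⟪b i, u⟫ ^ 2 := by
    rw [← Finset.mul_sum, b.sum_sq_inner_right]
  simp_rw [h]
  rw [integral_finsetSum _ fun i _ ↦ integrable_inner_sq_mul_inner_sq_stdGaussian _ _]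
  simp_rw [integral_inner_sq_mul_inner_sq_stdGaussian, b.norm_eq_one, Finset.sum_add_distrib,
    ← Finset.mul_sum, b.sum_sq_inner_left]
  simp
  ring

lemma integral_norm_sq_stdGaussian (b : OrthonormalBasis ι ℝ E) :
    ∫ u, ‖u‖ ^ 2 ∂(stdGaussian E) = Fintype.card ι := by
  simp_rw [← b.sum_sq_inner_right]
  rw [integral_finsetSum _ fun i _ ↦ integrable_inner_pow_stdGaussian _ 2]
  simp [integral_inner_sq_stdGaussian]

lemma integral_norm_pow_four_stdGaussian (b : OrthonormalBasis ι ℝ E) :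
    ∫ u, ‖u‖ ^ 4 ∂(stdGaussian E) = Fintype.card ι * (Fintype.card ι + 2) := by
  have h (u : E) : ‖u‖ ^ 4 = ∑ i, ⟪b i, u⟫ ^ 2 * ‖u‖ ^ 2 := by
    rw [← Finset.sum_mul, b.sum_sq_inner_right]
    ring
  simp_rw [h]
  rw [integral_finsetSum _ fun i _ ↦ ?_]
  · simp [integral_inner_sq_mul_norm_sq_stdGaussian b, mul_add]
  · simp_rw [← b.sum_sq_inner_right, Finset.mul_sum]
    exact integrable_finsetSum _ fun i _ ↦ integrable_inner_sq_mul_inner_sq_stdGaussian _ _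

/-- The power mean inequality reduces to sixth moments of coordinates, each 15. This crude bound is
enough for the variance. -/
lemma integral_norm_pow_six_stdGaussian_le (b : OrthonormalBasis ι ℝ E) :
    ∫ u, ‖u‖ ^ 6 ∂(stdGaussian E) ≤ 15 * (Fintype.card ι : ℝ) ^ 3 := by
  have h (u : E) : ‖u‖ ^ 6 ≤ ∑ i, (Fintype.card ι : ℝ) ^ 2 * ⟪b i, u⟫ ^ 6 := by
    have h3 := pow_sum_div_card_le_sum_pow (s := Finset.univ) (f := fun i ↦ ⟪b i, u⟫ ^ 2)
      (fun i _ ↦ sq_nonneg _) 2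
    rw [b.sum_sq_inner_right, Finset.card_univ] at h3
    rw [← Finset.mul_sum]
    rcases isEmpty_or_nonempty ι with hι | hι
    · have h0 : ‖u‖ ^ 2 = 0 := by simp [← b.sum_sq_inner_right u]
      simp [pow_eq_zero_iff] at h0
      simp [h0]
    · rw [div_le_iff₀' (by positivity)] at h3
      simp_rw [← pow_mul] at h3
      exact h3
  refine (integral_mono (integrable_norm_pow_stdGaussian 6) (integrable_finsetSum _ fun i _ ↦
    (integrable_inner_pow_stdGaussian (b i) 6).const_mul _) h).trans ?_
  rw [integral_finsetSum _ fun i _ ↦ (integrable_inner_pow_stdGaussian (b i) 6).const_mul _]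
  simp_rw [integral_const_mul, integral_inner_pow_six_stdGaussian, b.norm_eq_one]
  simp
  apply le_of_eq
  ring

end GaussianMoments

/-! ### Quadratic Taylor remainder -/

section Taylor

variable {E : Type*} [NormedAddCommGroup E] [InnerProductSpace ℝ E] [CompleteSpace E]

/-- Quadratic remainder bound for a function with Lipschitz gradient. -/
lemma abs_sub_sub_inner_gradient_le {φ : E → ℝ} (hφ : Differentiable ℝ φ) {L : ℝ≥0}
    (hL : LipschitzWith L (gradient φ)) (x h : E) :
    |φ (x + h) - φ x - ⟪gradient φ x, h⟫| ≤ L / 2 * ‖h‖ ^ 2 := by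
  have hd (t : ℝ) : HasDerivAt (fun t : ℝ ↦ φ (x + t • h) - φ x - t * ⟪gradient φ x, h⟫)
      (⟪gradient φ (x + t • h) - gradient φ x, h⟫) t := by
    have h1 : HasDerivAt (fun t : ℝ ↦ x + t • h) h t := by
      simpa using ((hasDerivAt_id t).smul_const h).const_add x
    have h2 := (hφ (x + t • h)).hasGradientAt.hasFDerivAt.comp_hasDerivAt t h1
    have h3 := (h2.sub_const (φ x)).sub ((hasDerivAt_id t).mul_const ⟪gradient φ x, h⟫)
    convert! h3 using 1
    simp [inner_sub_left]
  have hB (t : ℝ) : HasDerivAt (fun t : ℝ ↦ L / 2 * ‖h‖ ^ 2 * t ^ 2) (L * ‖h‖ ^ 2 * t) t := by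
    convert! (hasDerivAt_pow 2 t).const_mul (L / 2 * ‖h‖ ^ 2) using 1
    simp
    ring
  -- On `[0, 1]` the remainder along the segment is compared with `L/2 ‖h‖² t²`, whose derivative
  -- dominates.
  have key := image_norm_le_of_norm_deriv_right_le_deriv_boundary (a := 0) (b := 1)
    (fun t _ ↦ (hd t).continuousAt.continuousWithinAt) (fun t _ ↦ (hd t).hasDerivWithinAt)
    (by simp) hB (fun t ht ↦ ?_) (Set.right_mem_Icc.2 zero_le_one)
  · simpa using key
  · refine (norm_inner_le_norm _ _).trans ?_
    have h1 := hL.norm_sub_le (x + t • h) x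
    rw [add_sub_cancel_left, norm_smul, norm_of_nonneg ht.1] at h1
    calc _ ≤ L * (t * ‖h‖) * ‖h‖ := by gcongr
      _ = _ := by ring

end Taylor

/-! ### Chebyshev's inequality for vector sample means -/

section SampleMean

variable {ι κ Ω : Type*} [Fintype ι] [Fintype κ] [MeasurableSpace Ω] {P : Measure Ω}
  [IsProbabilityMeasure P] {X : κ → Ω → EuclideanSpace ℝ ι}

lemma memLp_sum_sub_integral (hX : ∀ i, MemLp (X i) 2 P) :
    MemLp (fun ω ↦ ∑ i, X i ω - ∑ i, ∫ ω, X i ω ∂P) 2 P :=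
  (memLp_finsetSum _ fun i _ ↦ hX i).sub (memLp_const _)

/-- The variance of a sum of independent random vectors is at most the sum of the second moments. -/
lemma integral_norm_sum_sub_integral_sq_le (hX : ∀ i, MemLp (X i) 2 P) (hind : iIndepFun X P) :
    ∫ ω, ‖∑ i, X i ω - ∑ i, ∫ ω, X i ω ∂P‖ ^ 2 ∂P ≤ ∑ i, ∫ ω, ‖X i ω‖ ^ 2 ∂P := by
  have hXk (i : κ) (k : ι) : MemLp (fun ω ↦ X i ω k) 2 P :=
    (EuclideanSpace.proj (𝕜 := ℝ) k).comp_memLp' (hX i)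
  have hint (i : κ) (k : ι) : (∫ ω, X i ω ∂P) k = ∫ ω, X i ω k ∂P :=
    ((EuclideanSpace.proj (𝕜 := ℝ) k).integral_comp_comm ((hX i).integrable (by norm_num))).symm
  -- Independence is used coordinate by coordinate, where variances of sums add.
  have hvar (k : ι) : ∫ ω, (∑ i, X i ω k - ∑ i, ∫ ω, X i ω k ∂P) ^ 2 ∂P
      = ∑ i, Var[fun ω ↦ X i ω k; P] := by
    rw [← IndepFun.variance_sum (fun i _ ↦ hXk i k), variance_eq_integral]
    · simp only [Finset.sum_apply]
      rw [integral_finsetSum _ fun i _ ↦ (hXk i k).integrable (by norm_num)]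
    · exact Finset.aemeasurable_sum _ fun i _ ↦ (hXk i k).aestronglyMeasurable.aemeasurable
    · intro i _ j _ hij
      exact (hind.indepFun hij).comp (φ := fun z : EuclideanSpace ℝ ι ↦ z k)
        (ψ := fun z : EuclideanSpace ℝ ι ↦ z k) (by fun_prop) (by fun_prop)
  have hsq (k : ι) :
      Integrable (fun ω ↦ (∑ i, X i ω k - ∑ i, ∫ ω, X i ω k ∂P) ^ 2) P :=
    ((memLp_finsetSum _ fun i _ ↦ hXk i k).sub (memLp_const _)).integrable_sq
  calc ∫ ω, ‖∑ i, X i ω - ∑ i, ∫ ω, X i ω ∂P‖ ^ 2 ∂P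
      = ∫ ω, ∑ k, (∑ i, X i ω k - ∑ i, ∫ ω, X i ω k ∂P) ^ 2 ∂P := by
        simp [EuclideanSpace.real_norm_sq_eq, hint]
    _ = ∑ k, ∑ i, Var[fun ω ↦ X i ω k; P] := by
        rw [integral_finsetSum _ fun k _ ↦ hsq k]
        simp_rw [hvar]
    _ ≤ ∑ k, ∑ i, ∫ ω, X i ω k ^ 2 ∂P := by
        gcongr with k _ i _
        exact variance_le_expectation_sq (hXk i k).aestronglyMeasurable
    _ = ∑ i, ∫ ω, ‖X i ω‖ ^ 2 ∂P := by
        rw [Finset.sum_comm]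
        refine Finset.sum_congr rfl fun i _ ↦ ?_
        simp_rw [EuclideanSpace.real_norm_sq_eq]
        rw [integral_finsetSum _ fun k _ ↦ (hXk i k).integrable_sq]

/-- Chebyshev's inequality for the mean of independent random vectors with common expectation. -/
lemma sq_mul_measureReal_le_norm_mean_sub_le {N : ℕ} (hN : 0 < N)
    {X : Fin N → Ω → EuclideanSpace ℝ ι} (hX : ∀ i, MemLp (X i) 2 P) (hind : iIndepFun X P)
    {m : EuclideanSpace ℝ ι} (hm : ∀ i, ∫ ω, X i ω ∂P = m) {V : ℝ}
    (hV : ∀ i, ∫ ω, ‖X i ω‖ ^ 2 ∂P ≤ V) {ρ : ℝ} (hρ : 0 ≤ ρ) :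
    N * ρ ^ 2 * P.real {ω | ρ ≤ ‖(1 / (N : ℝ)) • ∑ i, X i ω - m‖} ≤ V := by
  have hN0 : (0 : ℝ) < N := by exact_mod_cast hN
  have h1 := mul_meas_ge_le_integral_of_nonneg
    (ae_of_all P fun ω ↦ sq_nonneg ‖∑ i, X i ω - ∑ i, ∫ ω, X i ω ∂P‖)
    ((memLp_two_iff_integrable_sq_norm (memLp_sum_sub_integral hX).1).1
      (memLp_sum_sub_integral hX)) ((N * ρ) ^ 2)
  have h2 := h1.trans (integral_norm_sum_sub_integral_sq_le hX hind)
  have h3 : ∑ i, ∫ ω, ‖X i ω‖ ^ 2 ∂P ≤ N * V := by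
    simpa using Finset.sum_le_sum fun i (_ : i ∈ Finset.univ) ↦ hV i
  have hset : {ω | ρ ≤ ‖(1 / (N : ℝ)) • ∑ i, X i ω - m‖}
      = {ω | (N * ρ) ^ 2 ≤ ‖∑ i, X i ω - ∑ i, ∫ ω, X i ω ∂P‖ ^ 2} := by
    ext ω
    have he : ∑ i, X i ω - ∑ i, ∫ ω, X i ω ∂P
        = (N : ℝ) • ((1 / (N : ℝ)) • ∑ i, X i ω - m) := by
      simp_rw [hm]
      rw [smul_sub, smul_smul, mul_one_div_cancel hN0.ne', one_smul]
      simp [Nat.cast_smul_eq_nsmul]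
    simp only [Set.mem_ofPred_eq]
    rw [he, norm_smul, norm_of_nonneg hN0.le, pow_le_pow_iff_left₀ (by positivity) (by positivity)
      two_ne_zero, mul_le_mul_iff_right₀ hN0]
  rw [hset]
  refine le_of_mul_le_mul_left ?_ hN0
  calc _ = _ := by ring
    _ ≤ _ := h2.trans h3

end SampleMean

/-! ### Bias and second moment of one sample -/

section ForwardDifference

variable {n : ℕ}

/-- The forward difference `(f (x + σ u) - f x) / σ` of `f` at `x` in direction `u`. -/
noncomputable def forwardDifference (f : EuclideanSpace ℝ (Fin n) → ℝ) (σ : ℝ)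
    (x u : EuclideanSpace ℝ (Fin n)) : ℝ :=
  (f (x + σ • u) - f x) / σ

variable {f φ : EuclideanSpace ℝ (Fin n) → ℝ} {L : ℝ≥0} {ε σ : ℝ}

lemma measurable_forwardDifference (hf : Measurable f) (x : EuclideanSpace ℝ (Fin n)) :
    Measurable (forwardDifference f σ x) := by
  unfold forwardDifference
  fun_prop

/-- After removing the noise at the base point, the forward difference is linear up to
`Lσ (‖u‖² / 2 + 1)`. -/
lemma abs_forwardDifference_sub_inner_add_le (hφ : Differentiable ℝ φ)
    (hLip : LipschitzWith L (gradient φ)) (hnoise : ∀ y, |f y - φ y| ≤ ε) (hσ : 0 < σ)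
    (hε : ε ≤ L * σ ^ 2) (x u : EuclideanSpace ℝ (Fin n)) :
    |forwardDifference f σ x u - ⟪gradient φ x, u⟫ + (f x - φ x) / σ|
      ≤ L * σ * (‖u‖ ^ 2 / 2 + 1) := by
  have h1 := abs_sub_sub_inner_gradient_le hφ hLip x (σ • u)
  have h2 := hnoise (x + σ • u)
  rw [inner_smul_right, norm_smul, norm_of_nonneg hσ.le] at h1
  have he : forwardDifference f σ x u - ⟪gradient φ x, u⟫ + (f x - φ x) / σ
      = ((f (x + σ • u) - φ (x + σ • u))
        + (φ (x + σ • u) - φ x - σ * ⟪gradient φ x, u⟫)) / σ := by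
    unfold forwardDifference
    field_simp
    ring
  rw [he, abs_div, abs_of_pos hσ, div_le_iff₀ hσ]
  refine (abs_add_le _ _).trans ((add_le_add h2 h1).trans ?_)
  nlinarith

/-- For second moments the base-point noise does not cancel; it costs one more `Lσ`. -/
lemma abs_forwardDifference_sub_inner_le (hφ : Differentiable ℝ φ)
    (hLip : LipschitzWith L (gradient φ)) (hnoise : ∀ y, |f y - φ y| ≤ ε) (hσ : 0 < σ)
    (hε : ε ≤ L * σ ^ 2) (x u : EuclideanSpace ℝ (Fin n)) :
    |forwardDifference f σ x u - ⟪gradient φ x, u⟫| ≤ L * σ * (‖u‖ ^ 2 / 2 + 2) := by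
  have h1 := abs_forwardDifference_sub_inner_add_le hφ hLip hnoise hσ hε x u
  have h2 : |(f x - φ x) / σ| ≤ L * σ := by
    rw [abs_div, abs_of_pos hσ, div_le_iff₀ hσ]
    linarith [hnoise x]
  calc _ = |(forwardDifference f σ x u - ⟪gradient φ x, u⟫ + (f x - φ x) / σ)
        - (f x - φ x) / σ| := by ring_nf
    _ ≤ _ := abs_sub _ _
    _ ≤ L * σ * (‖u‖ ^ 2 / 2 + 1) + L * σ := add_le_add h1 h2
    _ = _ := by ring

lemma norm_forwardDifference_smul_sq_le (hφ : Differentiable ℝ φ)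
    (hLip : LipschitzWith L (gradient φ)) (hnoise : ∀ y, |f y - φ y| ≤ ε) (hσ : 0 < σ)
    (hε : ε ≤ L * σ ^ 2) (x u : EuclideanSpace ℝ (Fin n)) :
    ‖forwardDifference f σ x u • u‖ ^ 2 ≤ 3 / 2 * (⟪gradient φ x, u⟫ ^ 2 * ‖u‖ ^ 2)
      + 3 * (L * σ) ^ 2 * (1 / 4 * ‖u‖ ^ 6 + 2 * ‖u‖ ^ 4 + 4 * ‖u‖ ^ 2) := by
  have h := abs_forwardDifference_sub_inner_le hφ hLip hnoise hσ hε x u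
  rw [norm_smul, mul_pow, norm_eq_abs, sq_abs]
  set a := ⟪gradient φ x, u⟫
  set q := forwardDifference f σ x u
  have h1 : (q - a) ^ 2 ≤ (L * σ * (‖u‖ ^ 2 / 2 + 2)) ^ 2 := sq_le_sq' (abs_le.1 h).1 (abs_le.1 h).2
  -- Young's inequality, weighted to keep the constant on the dominant term `a ^ 2` small.
  have h2 : q ^ 2 ≤ 3 / 2 * a ^ 2 + 3 * (q - a) ^ 2 := by nlinarith [sq_nonneg (2 * q - 3 * a)]
  calc q ^ 2 * ‖u‖ ^ 2 ≤ (3 / 2 * a ^ 2 + 3 * (L * σ * (‖u‖ ^ 2 / 2 + 2)) ^ 2) * ‖u‖ ^ 2 := by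
        gcongr; linarith
    _ = _ := by ring

lemma integrable_inner_sq_mul_norm_sq (v : EuclideanSpace ℝ (Fin n)) :
    Integrable (fun u ↦ ⟪v, u⟫ ^ 2 * ‖u‖ ^ 2) (stdGaussian (EuclideanSpace ℝ (Fin n))) := by
  simp_rw [← (EuclideanSpace.basisFun (Fin n) ℝ).sum_sq_inner_right, Finset.mul_sum]
  exact integrable_finsetSum _ fun i _ ↦ integrable_inner_sq_mul_inner_sq_stdGaussian _ _

lemma integrable_forwardDifference_bound (v : EuclideanSpace ℝ (Fin n)) (s : ℝ) :
    Integrable (fun u ↦ 3 / 2 * (⟪v, u⟫ ^ 2 * ‖u‖ ^ 2)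
      + 3 * s ^ 2 * (1 / 4 * ‖u‖ ^ 6 + 2 * ‖u‖ ^ 4 + 4 * ‖u‖ ^ 2))
      (stdGaussian (EuclideanSpace ℝ (Fin n))) :=
  ((integrable_inner_sq_mul_norm_sq v).const_mul _).add
    (((((integrable_norm_pow_stdGaussian 6).const_mul _).add
      ((integrable_norm_pow_stdGaussian 4).const_mul _)).add
      ((integrable_norm_pow_stdGaussian 2).const_mul _)).const_mul _)

lemma memLp_forwardDifference_smul (hf : Measurable f) (hφ : Differentiable ℝ φ)
    (hLip : LipschitzWith L (gradient φ)) (hnoise : ∀ y, |f y - φ y| ≤ ε) (hσ : 0 < σ)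
    (hε : ε ≤ L * σ ^ 2) (x : EuclideanSpace ℝ (Fin n)) :
    MemLp (fun u ↦ forwardDifference f σ x u • u) 2
      (stdGaussian (EuclideanSpace ℝ (Fin n))) := by
  have hm : AEStronglyMeasurable (fun u ↦ forwardDifference f σ x u • u)
      (stdGaussian (EuclideanSpace ℝ (Fin n))) :=
    ((measurable_forwardDifference hf x).smul measurable_id).aestronglyMeasurable
  rw [memLp_two_iff_integrable_sq_norm hm]
  refine (integrable_forwardDifference_bound (gradient φ x) (L * σ)).mono' (by fun_prop)
    (ae_of_all _ fun u ↦ ?_)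
  rw [norm_of_nonneg (by positivity)]
  exact norm_forwardDifference_smul_sq_le hφ hLip hnoise hσ hε x u

lemma integral_norm_forwardDifference_smul_sq_le (hf : Measurable f) (hφ : Differentiable ℝ φ)
    (hLip : LipschitzWith L (gradient φ)) (hnoise : ∀ y, |f y - φ y| ≤ ε) (hσ : 0 < σ)
    (hε : ε ≤ L * σ ^ 2) (x : EuclideanSpace ℝ (Fin n)) :
    ∫ u, ‖forwardDifference f σ x u • u‖ ^ 2 ∂(stdGaussian (EuclideanSpace ℝ (Fin n)))
      ≤ 3 / 2 * ((n + 2) * ‖gradient φ x‖ ^ 2)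
        + 3 * (L * σ) ^ 2 * (1 / 4 * (15 * n ^ 3) + 2 * (n * (n + 2)) + 4 * n) := by
  have b := EuclideanSpace.basisFun (Fin n) ℝ
  have h6 := integral_norm_pow_six_stdGaussian_le b
  rw [Fintype.card_fin] at h6
  have hmem := memLp_forwardDifference_smul hf hφ hLip hnoise hσ hε x
  refine (integral_mono ((memLp_two_iff_integrable_sq_norm hmem.1).1 hmem)
    (integrable_forwardDifference_bound (gradient φ x) (L * σ))
    fun u ↦ norm_forwardDifference_smul_sq_le hφ hLip hnoise hσ hε x u).trans ?_
  have i6 := (integrable_norm_pow_stdGaussian (E := EuclideanSpace ℝ (Fin n)) 6).const_mul (1 / 4)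
  have i4 := (integrable_norm_pow_stdGaussian (E := EuclideanSpace ℝ (Fin n)) 4).const_mul 2
  have i2 := (integrable_norm_pow_stdGaussian (E := EuclideanSpace ℝ (Fin n)) 2).const_mul 4
  rw [integral_add ((integrable_inner_sq_mul_norm_sq _).const_mul _)
      (by exact ((i6.add i4).add i2).const_mul _), integral_const_mul, integral_const_mul,
    integral_add (by exact i6.add i4) i2, integral_add i6 i4, integral_const_mul,
    integral_const_mul, integral_const_mul, integral_inner_sq_mul_norm_sq_stdGaussian b,
    integral_norm_pow_four_stdGaussian b, integral_norm_sq_stdGaussian b, Fintype.card_fin]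
  gcongr

/-- Bias of the smoothed gradient. -/
lemma norm_integral_forwardDifference_smul_sub_gradient_le (hf : Measurable f)
    (hφ : Differentiable ℝ φ) (hLip : LipschitzWith L (gradient φ))
    (hnoise : ∀ y, |f y - φ y| ≤ ε) (hσ : 0 < σ) (hε : ε ≤ L * σ ^ 2)
    (x : EuclideanSpace ℝ (Fin n)) :
    ‖∫ u, forwardDifference f σ x u • u ∂(stdGaussian (EuclideanSpace ℝ (Fin n)))
      - gradient φ x‖ ≤ L * σ * ((n + 3) / 2) := by
  set γ := stdGaussian (EuclideanSpace ℝ (Fin n)) with hγ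
  set G := gradient φ x
  set m := ∫ u, forwardDifference f σ x u • u ∂γ
  have b := EuclideanSpace.basisFun (Fin n) ℝ
  have hY : Integrable (fun u ↦ forwardDifference f σ x u • u) γ :=
    (memLp_forwardDifference_smul hf hφ hLip hnoise hσ hε x).integrable (by norm_num)
  -- Testing against unit vectors avoids a factor `‖u‖`, since `E⟪v, u⟫² = 1`.
  have key (v : EuclideanSpace ℝ (Fin n)) (hv : ‖v‖ = 1) :
      ⟪v, m - G⟫ ≤ L * σ * ((n + 3) / 2) := by
    set c := (f x - φ x) / σ
    -- `E(‖u‖²/2 + 1)² = n(n+2)/4 + n + 1 ≤ a²`, so Young's inequality with weight `a` gives `a/2 +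
    -- a/2`.
    set a : ℝ := (n + 3) / 2 with ha
    have ha0 : 0 < a := by positivity
    have i1 : Integrable (fun u ↦ ⟪v, forwardDifference f σ x u • u⟫) γ := hY.const_inner v
    have i2 : Integrable (fun u ↦ ⟪G, u⟫ * ⟪v, u⟫) γ := integrable_inner_mul_stdGaussian G v
    have i3 : Integrable (fun u ↦ c * ⟪v, u⟫) γ := by
      simpa using (integrable_inner_pow_stdGaussian v 1).const_mul c
    have hzero : ∫ u, c * ⟪v, u⟫ ∂γ = 0 := by
      rw [integral_const_mul, show ∫ u, ⟪v, u⟫ ∂γ = 0 from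
        integral_strongDual_stdGaussian (innerSL ℝ v), mul_zero]
    have heq : ⟪v, m - G⟫
        = ∫ u, (⟪v, forwardDifference f σ x u • u⟫ - ⟪G, u⟫ * ⟪v, u⟫ + c * ⟪v, u⟫) ∂γ := by
      rw [integral_add (by exact i1.sub i2) i3, integral_sub i1 i2, hzero, integral_inner hY,
        integral_inner_mul_inner_stdGaussian, inner_sub_right, real_inner_comm G v, add_zero]
    have j4 := (integrable_norm_pow_stdGaussian (E := EuclideanSpace ℝ (Fin n)) 4).const_mul (1 / 4)
    have j2 := integrable_norm_pow_stdGaussian (E := EuclideanSpace ℝ (Fin n)) 2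
    have j1 : Integrable (fun _ : EuclideanSpace ℝ (Fin n) ↦ (1 : ℝ)) γ := integrable_const 1
    have jv := (integrable_inner_pow_stdGaussian v 2).const_mul (a / 2)
    have jb : Integrable (fun u ↦ (1 / 4 * ‖u‖ ^ 4 + ‖u‖ ^ 2 + 1) / (2 * a)) γ :=
      ((j4.add j2).add j1).div_const _
    have hle (u : EuclideanSpace ℝ (Fin n)) :
        ⟪v, forwardDifference f σ x u • u⟫ - ⟪G, u⟫ * ⟪v, u⟫ + c * ⟪v, u⟫
          ≤ L * σ * ((1 / 4 * ‖u‖ ^ 4 + ‖u‖ ^ 2 + 1) / (2 * a) + a / 2 * ⟪v, u⟫ ^ 2) := by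
      have h1 := abs_forwardDifference_sub_inner_add_le hφ hLip hnoise hσ hε x u
      have hamgm : (‖u‖ ^ 2 / 2 + 1) * |⟪v, u⟫|
          ≤ (1 / 4 * ‖u‖ ^ 4 + ‖u‖ ^ 2 + 1) / (2 * a) + a / 2 * ⟪v, u⟫ ^ 2 := by
        rw [← sub_nonneg]
        have : (1 / 4 * ‖u‖ ^ 4 + ‖u‖ ^ 2 + 1) / (2 * a) + a / 2 * ⟪v, u⟫ ^ 2
            - (‖u‖ ^ 2 / 2 + 1) * |⟪v, u⟫|
            = (‖u‖ ^ 2 / 2 + 1 - a * |⟪v, u⟫|) ^ 2 / (2 * a) := by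
          rw [← sq_abs ⟪v, u⟫]
          field_simp
          ring
        rw [this]
        positivity
      calc _ = (forwardDifference f σ x u - ⟪G, u⟫ + c) * ⟪v, u⟫ := by
            rw [inner_smul_right]; ring
        _ ≤ |forwardDifference f σ x u - ⟪G, u⟫ + c| * |⟪v, u⟫| := by
            rw [← abs_mul]; exact le_abs_self _
        _ ≤ L * σ * (‖u‖ ^ 2 / 2 + 1) * |⟪v, u⟫| := by gcongr
        _ = L * σ * ((‖u‖ ^ 2 / 2 + 1) * |⟪v, u⟫|) := by ring
        _ ≤ _ := by gcongr
    rw [heq]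
    refine (integral_mono (by exact (i1.sub i2).add i3)
      (by exact (jb.add jv).const_mul (L * σ)) hle).trans ?_
    rw [integral_const_mul, integral_add jb jv, integral_div, integral_add (by exact j4.add j2) j1,
      integral_add j4 j2, integral_const_mul, integral_const_mul, integral_inner_sq_stdGaussian,
      integral_norm_pow_four_stdGaussian b, integral_norm_sq_stdGaussian b, Fintype.card_fin, hv,
      integral_const, probReal_univ]
    gcongr
    have hdiv : (1 / 4 * ((n : ℝ) * (n + 2)) + n + 1) / (2 * a) ≤ a / 2 := by
      rw [div_le_iff₀ (by positivity), ha]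
      nlinarith
    simp only [smul_eq_mul, mul_one, one_pow]
    linarith
  rcases eq_or_ne (m - G) 0 with h0 | h0
  · rw [h0, norm_zero]
    positivity
  · have h1 := key (‖m - G‖⁻¹ • (m - G)) (by rw [norm_smul, norm_inv, norm_norm,
      inv_mul_cancel₀ (norm_ne_zero_iff.2 h0)])
    rw [real_inner_smul_left, real_inner_self_eq_norm_sq, sq, ← mul_assoc,
      inv_mul_cancel₀ (norm_ne_zero_iff.2 h0), one_mul] at h1
    exact h1

end ForwardDifference

/-- The sample size condition implies a linear lower bound on `δ θ² N`. -/
lemma linear_le_mul_of_sample_size {n N : ℕ} (hn : 1 < n) {θ δ : ℝ} (hθ : 0 < θ) (hδ : 0 < δ)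
    (hN : 3 * (n : ℝ) / (δ * θ ^ 2) * ((n : ℝ) / (√(n : ℝ) - 1) ^ 2)
      + ((n : ℝ) + 4) / (16 * δ) + 1 / δ ≤ (N : ℝ)) :
    3 * (n : ℝ) + 6 ≤ δ * θ ^ 2 * N := by
  have hs : 1 < √(n : ℝ) := by
    rw [lt_sqrt zero_le_one]
    exact_mod_cast hn
  have hss : √(n : ℝ) ^ 2 = n := sq_sqrt (Nat.cast_nonneg n)
  set s := √(n : ℝ)
  -- With `n = s²`, the difference `s⁴ - (s² + 2)(s - 1)²` equals `2s(s - 1)² + s² + 2s - 2`,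
  -- positive for `s > 1`.
  have h1 : (n : ℝ) + 2 ≤ n * (n / (s - 1) ^ 2) := by
    rw [← mul_div_assoc, le_div_iff₀ (by nlinarith), ← hss]
    nlinarith [mul_nonneg (by linarith : 0 ≤ s) (sq_nonneg (s - 1))]
  have h2 : 3 * (n : ℝ) / (δ * θ ^ 2) * ((n : ℝ) / (s - 1) ^ 2) ≤ N := by
    have : 0 ≤ ((n : ℝ) + 4) / (16 * δ) := by positivity
    have : 0 ≤ 1 / δ := by positivity
    linarith
  calc 3 * (n : ℝ) + 6 ≤ 3 * (n * (n / (s - 1) ^ 2)) := by linarith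
    _ = δ * θ ^ 2 * (3 * (n : ℝ) / (δ * θ ^ 2) * ((n : ℝ) / (s - 1) ^ 2)) := by
        field_simp
    _ ≤ _ := by gcongr

end GaussianSmoothing

/-! ### The norm condition with high probability -/

open GaussianSmoothing MeasureTheory ProbabilityTheory in
theorem corollary2p7 {n N : ℕ} (hn : 1 < n)
    -- the smooth function `φ`, with `L`-Lipschitz gradient
    (φ : EuclideanSpace ℝ (Fin n) → ℝ) (hφ : ContDiff ℝ 1 φ)
    (L : ℝ≥0) (hL : 0 < L) (hLip : LipschitzWith L (gradient φ))
    -- its approximation `f`, with noise bounded by `εf`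
    (f : EuclideanSpace ℝ (Fin n) → ℝ) (hf : Measurable f)
    (εf : ℝ) (hεf : 0 ≤ εf) (hnoise : ∀ y, |f y - φ y| ≤ εf)
    -- the sampling directions: independent, each with law `𝒩(0, I)`
    {Ω : Type*} [MeasurableSpace Ω] (P : MeasureTheory.Measure Ω)
    [MeasureTheory.IsProbabilityMeasure P]
    (u : Fin N → Ω → EuclideanSpace ℝ (Fin n))
    (hindep : ProbabilityTheory.iIndepFun u P)
    (hlaw : ∀ i, ProbabilityTheory.HasLaw (u i)
      (ProbabilityTheory.stdGaussian (EuclideanSpace ℝ (Fin n))) P)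
    (x : EuclideanSpace ℝ (Fin n)) (θ δ σ : ℝ)
    (hθ : 0 < θ) (hθ1 : θ < 1) (hδ : 0 < δ) (hδ1 : δ < 1) (hσ : 0 < σ)
    (hN : 3 * (n : ℝ) / (δ * θ ^ 2) * ((n : ℝ) / (√(n : ℝ) - 1) ^ 2)
      + ((n : ℝ) + 4) / (16 * δ) + 1 / δ ≤ (N : ℝ))
    (hσ_lower : √(εf / (L : ℝ)) ≤ σ)
    (hσ_upper : σ ≤ θ * ‖gradient φ x‖ / (6 * (n : ℝ) * (L : ℝ)))
    (hgrad : 6 * (n : ℝ) * √((L : ℝ) * εf) / θ ≤ ‖gradient φ x‖) :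
    1 - δ ≤ P.real {ω |
      NormCondition φ θ (gaussianSmoothedGradient f σ (fun i => u i ω) x) x} := by
  have hn2 : (2 : ℝ) ≤ n := by exact_mod_cast hn
  have hn0 : (0 : ℝ) < n := by linarith
  have hL0 : (0 : ℝ) < L := by exact_mod_cast hL
  have hdiff : Differentiable ℝ φ := hφ.differentiable one_ne_zero
  have hε : εf ≤ L * σ ^ 2 := by
    have := (Real.sqrt_le_left hσ.le).1 hσ_lower
    rwa [div_le_iff₀' hL0] at this
  have hs : 6 * n * (L * σ) ≤ θ * ‖gradient φ x‖ := by
    rw [le_div_iff₀ (by positivity)] at hσ_upper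
    linarith
  have hs0 : 0 < (L : ℝ) * σ := by positivity
  have hG : 0 < ‖gradient φ x‖ := by
    have : 0 < θ * ‖gradient φ x‖ := lt_of_lt_of_le (by positivity) hs
    exact pos_of_mul_pos_right this hθ.le
  have hNδ := linear_le_mul_of_sample_size hn hθ hδ hN
  have hN0 : 0 < N := by
    rcases Nat.eq_zero_or_pos N with h | h
    · rw [h] at hNδ
      norm_num at hNδ
      linarith
    · exact h
  have hbias := norm_integral_forwardDifference_smul_sub_gradient_le hf hdiff hLip hnoise hσ hε x
  have hvar := integral_norm_forwardDifference_smul_sq_le hf hdiff hLip hnoise hσ hε x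
  have hmem := memLp_forwardDifference_smul hf hdiff hLip hnoise hσ hε x
  have hYm : Measurable (fun v ↦ forwardDifference f σ x v • v) :=
    (measurable_forwardDifference hf x).smul measurable_id
  set m := ∫ v, forwardDifference f σ x v • v ∂(stdGaussian (EuclideanSpace ℝ (Fin n)))
  have hcheb := sq_mul_measureReal_le_norm_mean_sub_le hN0
    (X := fun i ω ↦ forwardDifference f σ x (u i ω) • u i ω)
    (fun i ↦ by
      have h := hmem
      rw [← (hlaw i).map_eq] at h
      exact h.comp_of_map (hlaw i).aemeasurable)
    (hindep.comp (fun _ v ↦ forwardDifference f σ x v • v) fun _ ↦ hYm)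
    (fun i ↦ (hlaw i).integral_comp hYm.aestronglyMeasurable)
    (fun i ↦ ((hlaw i).integral_comp
      (hYm.norm.pow_const 2).aestronglyMeasurable).trans_le hvar)
    (ρ := 19 / 24 * (θ * ‖gradient φ x‖)) (by positivity)
  set bad := {ω | 19 / 24 * (θ * ‖gradient φ x‖)
    ≤ ‖(1 / (N : ℝ)) • ∑ i, forwardDifference f σ x (u i ω) • u i ω - m‖}
  have hbad : P.real bad ≤ δ := by
    have hs2 : (6 * n * (L * σ)) ^ 2 ≤ (θ * ‖gradient φ x‖) ^ 2 := by gcongr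
    have hθ2 : θ ^ 2 ≤ 1 := by nlinarith
    have hV : 3 / 2 * ((n + 2) * ‖gradient φ x‖ ^ 2)
        + 3 * (L * σ) ^ 2 * (1 / 4 * (15 * n ^ 3) + 2 * (n * (n + 2)) + 4 * n)
        ≤ (29 / 16 * n + 7 / 2) * ‖gradient φ x‖ ^ 2 := by
      have h1 : 3 * (L * σ) ^ 2 * (1 / 4 * (15 * n ^ 3) + 2 * (n * (n + 2)) + 4 * n)
          ≤ (5 / 16 * n + 1 / 2) * (6 * n * (L * σ)) ^ 2 := by
        -- The cubic terms agree; what remains is `2n² + 8n ≤ 6n²`, that is `n ≥ 2`.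
        have : 1 / 4 * (15 * (n : ℝ) ^ 3) + 2 * (n * (n + 2)) + 4 * n
            ≤ 12 * n ^ 2 * (5 / 16 * n + 1 / 2) := by nlinarith
        calc _ ≤ 3 * (L * σ) ^ 2 * (12 * (n : ℝ) ^ 2 * (5 / 16 * n + 1 / 2)) := by gcongr
          _ = _ := by ring
      have h2 : (6 * n * (L * σ)) ^ 2 ≤ ‖gradient φ x‖ ^ 2 := by
        refine hs2.trans ?_
        rw [mul_pow]
        exact mul_le_of_le_one_left (by positivity) hθ2
      have h3 := mul_le_mul_of_nonneg_left h2 (by positivity : 0 ≤ 5 / 16 * (n : ℝ) + 1 / 2)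
      linarith
    have hpos : 0 < N * (19 / 24 * (θ * ‖gradient φ x‖)) ^ 2 := by positivity
    refine le_of_mul_le_mul_left (hcheb.trans (hV.trans ?_)) hpos
    have h4 := mul_le_mul_of_nonneg_right hNδ
      (by positivity : 0 ≤ (19 / 24) ^ 2 * ‖gradient φ x‖ ^ 2)
    -- Numerically `3(19/24)² ≈ 1.88 ≥ 29/16` and `6(19/24)² ≈ 3.76 ≥ 7/2`.
    have h5 : (29 / 16 * (n : ℝ) + 7 / 2) * ‖gradient φ x‖ ^ 2
        ≤ (3 * n + 6) * ((19 / 24) ^ 2 * ‖gradient φ x‖ ^ 2) := by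
      rw [← mul_assoc]
      gcongr
      linarith
    calc _ ≤ _ := h5.trans h4
      _ = _ := by ring
  -- Covering the space and using subadditivity requires no measurability of either event.
  have hsub : Set.univ ⊆ {ω | NormCondition φ θ
      (gaussianSmoothedGradient f σ (fun i => u i ω) x) x} ∪ bad := by
    intro ω _
    by_cases hω : ω ∈ bad
    · exact Or.inr hω
    · refine Or.inl ?_
      have hlt : ‖gaussianSmoothedGradient f σ (fun i => u i ω) x - m‖
          < 19 / 24 * (θ * ‖gradient φ x‖) := not_le.1 hω
      have htri := norm_sub_le_norm_sub_add_norm_sub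
        (gaussianSmoothedGradient f σ (fun i => u i ω) x) m (gradient φ x)
      -- Since `n ≥ 2`, `(n + 3)/2 ≤ 5n/4`, and `5/4 · 1/6 = 5/24`.
      have hb : (L : ℝ) * σ * ((n + 3) / 2) ≤ 5 / 24 * (θ * ‖gradient φ x‖) := by
        have : (L : ℝ) * σ * ((n + 3) / 2) ≤ L * σ * (5 / 4 * n) := by gcongr; linarith
        linarith
      change ‖_ - gradient φ x‖ ≤ θ * ‖gradient φ x‖
      linarith
  have h1 : (1 : ℝ) ≤ P.real {ω | NormCondition φ θ
      (gaussianSmoothedGradient f σ (fun i => u i ω) x) x} + P.real bad := by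
    rw [← probReal_univ (μ := P)]
    exact (measureReal_mono hsub).trans (measureReal_union_le _ _)
  linarith
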